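/- Let $A$ be a finite alphabet and let $L\subseteq A^*$ be a rational language, i.e. a language obtained from $\emptyset$ and the languages $\{a\}$ ($a\in A$) by finitely many unions, concatenation products and Kleene stars. Then the following four conditions are equivalent. 1. $L$ is star-free, i.e. $L$ can be obtained from $\emptyset$ and the languages $\{a\}$ ($a\in A$) by finitely many unions, intersections, complements in $A^*$ and concatenation products. 2. $L$ is definable by a sentence of $\mathsf{FO}(<)$, i.e. there is a first-order sentence $\varphi$, built from equality, the binary symbol $<$ and unary symbols $R_a$ ($a\in A$), such that $L$ is the set of all words $w$ satisfying $\varphi$; here variables range over the set $\{0,\dots,|w|-1\}$ of positions of $w$ (empty for the empty word), $<$ is the usual order, and $R_a x$ means that the letter in position $x$ is $a$. 3. $L$ is recognized by an aperiodic finite monoid, i.e. there are a finite aperiodic monoid $M$, a monoid morphism $\phi\colon A^*\to M$ and a subset $X\subseteq M$ such that $L=\phi^{-1}(X)$. 4. The syntactic monoid $M(L)=A^*/{\cong_L}$ is aperiodic, where $u\cong_L v$ if and only if for all $x,y\in A^*$: $xuy\in L\Leftrightarrow xvy\in L$. Here a monoid is called aperiodic if it contains no nontrivial group, i.e. every subsemigroup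 that is a group under the multiplication of the monoid (its identity may differ from that of the monoid) has exactly one element. -/

import Mathlib

universe u v

namespace FOWords

section Languages

variable {A : Type u}

/-- A language is rational if it is obtained from `∅` and the letters by finitely many unions,
products and iterations, that is, if it is denoted by a (usual) rational expression. -/
def IsRational (L : Language A) : Prop :=
  ∃ P : RegularExpression A, P.matches' = L

/-- Star-free languages: those denoted by an extended rational expression that uses neither
iteration nor morphic images. Here `0` is the empty language, `K + L` the union, `K * L` the
concatenation product, `K ⊓ L` the intersection and `Lᶜ` the complement in `A*`. -/
inductive IsStarFree : Language A → Prop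
  | empty : IsStarFree 0
  | letter (a : A) : IsStarFree {[a]}
  | union {K L : Language A} : IsStarFree K → IsStarFree L → IsStarFree (K + L)
  | product {K L : Language A} : IsStarFree K → IsStarFree L → IsStarFree (K * L)
  | inter {K L : Language A} : IsStarFree K → IsStarFree L → IsStarFree (K ⊓ L)
  | compl {L : Language A} : IsStarFree L → IsStarFree Lᶜ

end Languages

section Logic

/-- The non-logical symbols of `FO(<)` over the alphabet `A`: the binary symbol `<` and, for each
letter `a`, the unary symbol `R_a`. (Equality is a logical symbol.) -/
inductive WordRel (A : Type u) : ℕ → Type u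
  | lt : WordRel A 2
  | letter (a : A) : WordRel A 1

/-- The first-order signature of `FO(<)` over the alphabet `A`. -/
def foLT (A : Type u) : FirstOrder.Language.{0, u} :=
  ⟨fun _ => Empty, WordRel A⟩

variable {A : Type u}

/-- The set `{0, …, |w| - 1}` of positions of a word. -/
abbrev Dom (w : List A) : Type := Fin w.length

/-- A word as a first-order structure (with empty domain for the empty word). -/
instance wordStructure (w : List A) : (foLT A).Structure (Dom w) where
  funMap := fun f _ => Empty.elim f
  RelMap := fun {_} R =>
    match R with
    | .lt => fun x => x 0 < x 1
    | .letter a => fun x => w.get (x 0) = a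

/-- The language `L(φ)` of all words that satisfy the sentence `φ` of `FO(<)`. -/
def sentenceLanguage (φ : (foLT A).Sentence) : Language A :=
  {w : List A | FirstOrder.Language.Sentence.Realize (Dom w) φ}

/-- `L` is definable by a sentence of `FO(<)`. -/
def IsFODefinable (L : Language A) : Prop :=
  ∃ φ : (foLT A).Sentence, sentenceLanguage φ = L

end Logic

section Algebra

/-- A subsemigroup of `M` is a group if it is a group under the multiplication of `M`. Its
identity need not be the identity of `M`. -/
def IsGroupIn {M : Type v} [Monoid M] (G : Subsemigroup M) : Prop :=
  ∃ e ∈ G, (∀ g ∈ G, e * g = g ∧ g * e = g) ∧ ∀ g ∈ G, ∃ h ∈ G, g * h = e ∧ h * g = e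

/-- A monoid is aperiodic if it contains no nontrivial group. -/
def IsAperiodic (M : Type v) [Monoid M] : Prop :=
  ∀ G : Subsemigroup M, IsGroupIn G → ∀ g ∈ G, ∀ h ∈ G, g = h

variable {A : Type u}

/-- `M` recognizes `L` if `L = φ⁻¹(X)` for some morphism `φ : A* → M` and some `X ⊆ M`. -/
def Recognizes (M : Type v) [Monoid M] (L : Language A) : Prop :=
  ∃ (φ : FreeMonoid A →* M) (X : Set M), ∀ w : List A, w ∈ L ↔ φ (FreeMonoid.ofList w) ∈ X

/-- The syntactic congruence of `L`: `u ≅ v` iff for all `x, y`, `xuy ∈ L ↔ xvy ∈ L`. -/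
def syntacticCon (L : Language A) : Con (FreeMonoid A) where
  r u v := ∀ x y : FreeMonoid A,
    (x * u * y).toList ∈ L ↔ (x * v * y).toList ∈ L
  iseqv := ⟨fun _ _ _ => Iff.rfl, fun h x y => (h x y).symm,
    fun h₁ h₂ x y => (h₁ x y).trans (h₂ x y)⟩
  mul' := by
    intro a b c d hab hcd x y
    have h₁ := hab x (c * y)
    have h₂ := hcd (x * b) y
    simp only [mul_assoc] at h₁ h₂ ⊢
    exact h₁.trans h₂

/-- The syntactic monoid `M(L)`, the quotient of `A*` by the syntactic congruence. -/
abbrev SyntacticMonoid (L : Language A) : Type u := (syntacticCon L).Quotient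

end Algebra

end FOWords

/-! A finite monoid is aperiodic exactly when x^(n+1) = x^n holds in it for some uniform n
(`PowStable`). This identity passes to the syntactic monoid of every recognized language and to the
monoids built below. Rationality enters only through the finiteness of the syntactic monoid.

Star-free to logic: a star-free expression is translated into a formula about the factor between two
variables, so that a product becomes a quantifier over the cutting position
(`IsStarFree.isDefinable_factor`).

Logic to aperiodic: a formula with n variables is recognized over letters marked with the variables
placed at them. Existential quantification, which forgets a mark, is simulated by `PowersetProduct`,
and this construction preserves `PowStable`.

Aperiodic to star-free: induction on the size of M, then on the set B of letters in use. If a letter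
c has value different from 1, a word containing c is cut at its first and last c. The outer pieces
avoid c; the middle is read block by block in the local divisor at the value of c, which is smaller
than M because M is aperiodic (`LocalDivisor.card_lt`, `isStarFree_prod_eq`). -/

namespace FOWords

/-! ### Rational languages have finite syntactic monoids -/

section Regular

variable {A : Type u}

/-- By induction on words every left quotient of L stays in F, so Myhill–Nerode applies. -/
theorem isRegular_of_leftQuotient_mem {L : Language A} (F : Set (Language A)) (hF : F.Finite)
    (hL : L ∈ F) (hc : ∀ K ∈ F, ∀ a, K.leftQuotient [a] ∈ F) : L.IsRegular := by
  have key : ∀ w : List A, ∀ K ∈ F, K.leftQuotient w ∈ F := by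
    intro w
    induction w with
    | nil => intro K hK; simpa using hK
    | cons a w ih =>
      intro K hK
      have := Language.leftQuotient_append K [a] w
      rw [List.singleton_append] at this
      rw [this]
      exact ih _ (hc K hK a)
  refine .of_finite_range_leftQuotient (hF.subset ?_)
  rintro _ ⟨w, rfl⟩
  exact key w L hL

theorem cons_mem_mul {K L : Language A} {a : A} {y : List A} :
    a :: y ∈ K * L ↔ y ∈ K.leftQuotient [a] * L ∨ ([] ∈ K ∧ y ∈ L.leftQuotient [a]) := by
  simp only [Language.mem_mul, Language.mem_leftQuotient, List.singleton_append]
  constructor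
  · rintro ⟨s, hs, t, ht, h⟩
    rcases s with _ | ⟨b, s⟩
    · right
      simp only [List.nil_append] at h
      exact ⟨hs, h ▸ ht⟩
    · simp only [List.cons_append, List.cons.injEq] at h
      obtain ⟨rfl, rfl⟩ := h
      exact Or.inl ⟨s, hs, t, ht, rfl⟩
  · rintro (⟨s, hs, t, ht, rfl⟩ | ⟨h, h'⟩)
    · exact ⟨a :: s, hs, t, ht, rfl⟩
    · exact ⟨[], h, _, h', rfl⟩

theorem cons_mem_kstar {L : Language A} {a : A} {y : List A} :
    a :: y ∈ KStar.kstar L ↔ y ∈ L.leftQuotient [a] * KStar.kstar L := by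
  constructor
  · intro h
    obtain ⟨S, hS, hS'⟩ := Language.mem_kstar_iff_exists_nonempty.1 h
    rcases S with _ | ⟨_ | ⟨b, s⟩, S⟩
    · simp at hS
    · simpa using hS' [] (by simp)
    · simp only [List.flatten_cons, List.cons_append, List.cons.injEq] at hS
      obtain ⟨rfl, rfl⟩ := hS
      exact Language.append_mem_mul (by simpa using (hS' (a :: s) (by simp)).1)
        (Language.join_mem_kstar fun z hz => (hS' z (by simp [hz])).1)
  · intro h
    rw [← Language.one_add_self_mul_kstar_eq_kstar, Language.mem_add, cons_mem_mul]
    exact Or.inr (Or.inl h)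

theorem leftQuotient_iSup (S : Set (Language A)) (a : A) :
    (⨆ N ∈ S, N).leftQuotient [a] = ⨆ N ∈ (fun N : Language A => N.leftQuotient [a]) '' S, N := by
  ext y
  simp [Language.mem_iSup]

/-- Every left quotient of KL is NL together with a union of quotients of L, where N is a quotient
of K. Only finitely many languages have this form. -/
theorem IsRegular.mul {K L : Language A} (hK : K.IsRegular) (hL : L.IsRegular) :
    (K * L).IsRegular := by
  refine isRegular_of_leftQuotient_mem
    (Set.image2 (fun N S => N * L + ⨆ N ∈ S, N) (Set.range K.leftQuotient)
      {S | S ⊆ Set.range L.leftQuotient})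
    (hK.finite_range_leftQuotient.image2 _ hL.finite_range_leftQuotient.finite_subsets)
    ⟨K, ⟨[], rfl⟩, ∅, by simp, by simp; exact add_zero _⟩ ?_
  rintro _ ⟨_, ⟨w, rfl⟩, S, hS, rfl⟩ a
  -- A new quotient of L joins the union exactly when the word read so far lies in K.
  refine ⟨_, ⟨w ++ [a], rfl⟩, (fun N : Language A => N.leftQuotient [a]) '' S ∪
    {N | [] ∈ K.leftQuotient w ∧ N = L.leftQuotient [a]}, ?_, ?_⟩
  · rintro N (⟨N, hN, rfl⟩ | ⟨-, rfl⟩)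
    · obtain ⟨x, rfl⟩ := hS hN
      exact ⟨x ++ [a], Language.leftQuotient_append _ _ _⟩
    · exact ⟨[a], rfl⟩
  · ext y
    have h := @cons_mem_mul _ (K.leftQuotient w) L a y
    rw [← Language.leftQuotient_append] at h
    dsimp only
    rw [Language.mem_leftQuotient [a] y, List.singleton_append, Language.mem_add,
      Language.mem_add, h, or_assoc]
    refine or_congr_right ?_
    have h' := Language.mem_leftQuotient (L := ⨆ N ∈ S, N) [a] y
    rw [List.singleton_append] at h'
    rw [← h', leftQuotient_iSup]
    simp only [Language.mem_iSup]
    constructor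
    · rintro ⟨N, hN | ⟨h, rfl⟩, hy⟩
      · exact Or.inr ⟨N, hN, hy⟩
      · exact Or.inl ⟨h, hy⟩
    · rintro (⟨h, hy⟩ | ⟨N, hN, hy⟩)
      · exact ⟨_, Or.inr ⟨h, rfl⟩, hy⟩
      · exact ⟨N, Or.inl hN, hy⟩

/-- A quotient by a nonempty word is a union of quotients of L, followed by L*; the empty word
contributes L* itself. -/
theorem IsRegular.kstar {L : Language A} (hL : L.IsRegular) : (KStar.kstar L).IsRegular := by
  refine isRegular_of_leftQuotient_mem
    (insert (KStar.kstar L) ((fun S : Set (Language A) => (⨆ N ∈ S, N) * KStar.kstar L) ''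
      {S | S ⊆ Set.range L.leftQuotient}))
    ((hL.finite_range_leftQuotient.finite_subsets.image _).insert _) (Set.mem_insert _ _) ?_
  rintro _ (rfl | ⟨S, hS, rfl⟩) a
  · refine Or.inr ⟨{L.leftQuotient [a]}, by simp, ?_⟩
    ext y
    rw [Language.mem_leftQuotient, List.singleton_append, cons_mem_kstar]
    simp
  · refine Or.inr ⟨(fun N : Language A => N.leftQuotient [a]) '' S ∪
      {N | [] ∈ (⨆ N ∈ S, N) ∧ N = L.leftQuotient [a]}, ?_, ?_⟩
    · rintro N (⟨N, hN, rfl⟩ | ⟨-, rfl⟩)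
      · obtain ⟨x, rfl⟩ := hS hN
        exact ⟨x ++ [a], Language.leftQuotient_append _ _ _⟩
      · exact ⟨[a], rfl⟩
    · ext y
      rw [Language.mem_leftQuotient, List.singleton_append, cons_mem_mul,
        Language.mem_leftQuotient, List.singleton_append, cons_mem_kstar]
      simp only [Language.mem_mul, Language.mem_iSup, Language.mem_leftQuotient]
      constructor
      · rintro ⟨s, ⟨N, h, hs⟩, r⟩
        rcases h with ⟨N, hN, rfl⟩ | ⟨h, rfl⟩
        · exact Or.inl ⟨s, ⟨N, hN, hs⟩, r⟩
        · exact Or.inr ⟨by simpa [Language.mem_iSup] using h, s, hs, r⟩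
      · rintro (⟨s, ⟨N, hN, hs⟩, r⟩ | ⟨h, s, hs, r⟩)
        · exact ⟨s, ⟨_, Or.inl ⟨N, hN, rfl⟩, hs⟩, r⟩
        · exact ⟨s, ⟨_, Or.inr ⟨by simpa [Language.mem_iSup] using h, rfl⟩, hs⟩, r⟩

theorem IsRegular.zero : (0 : Language A).IsRegular := by
  refine isRegular_of_leftQuotient_mem {0} (Set.finite_singleton _) rfl ?_
  rintro _ rfl a
  rfl

theorem IsRegular.one : (1 : Language A).IsRegular := by
  refine isRegular_of_leftQuotient_mem {0, 1} (by simp) (by simp) ?_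
  rintro _ (rfl | rfl) a
  · exact Or.inl rfl
  · left
    ext y
    simp

theorem IsRegular.letter (b : A) : ({[b]} : Language A).IsRegular := by
  refine isRegular_of_leftQuotient_mem {0, 1, {[b]}} (by simp) (by simp) ?_
  rintro _ (rfl | rfl | rfl) a
  · exact Or.inl rfl
  · left
    ext y
    simp
  · by_cases h : a = b
    · right; left
      ext y
      change [a] ++ y = [b] ↔ y = []
      simp [h]
    · left
      ext y
      change [a] ++ y = [b] ↔ False
      simp [h]

theorem IsRational.isRegular {L : Language A} (hL : IsRational L) : L.IsRegular := by
  obtain ⟨P, rfl⟩ := hL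
  induction P with
  | zero => exact IsRegular.zero
  | epsilon => exact IsRegular.one
  | char a => exact IsRegular.letter a
  | plus P Q hP hQ => exact hP.add hQ
  | comp P Q hP hQ => exact IsRegular.mul hP hQ
  | star P hP => exact IsRegular.kstar hP

/-- Words that act alike on the states of an automaton are congruent, and there are finitely many
such actions. -/
theorem finite_syntacticMonoid {L : Language A} (hL : L.IsRegular) :
    Finite (SyntacticMonoid L) := by
  obtain ⟨σ, _, D, rfl⟩ := hL
  let f : FreeMonoid A → σ → σ := fun w s => D.evalFrom s w.toList
  have hf : ∀ p : Set.range f, ∃ w, f w = p.1 := fun p => p.2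
  choose g hg using hf
  refine Finite.of_surjective
    (fun p : Set.range f => ((g p : FreeMonoid A) : SyntacticMonoid D.accepts)) ?_
  intro m
  induction m using Con.induction_on with
  | H w =>
    refine ⟨⟨f w, w, rfl⟩, (Con.eq _).2 fun x y => ?_⟩
    have := congrFun (hg ⟨f w, w, rfl⟩) (D.evalFrom D.start x.toList)
    change D.evalFrom _ (g ⟨f w, w, rfl⟩).toList = D.evalFrom _ w.toList at this
    simp only [FreeMonoid.toList_mul, DFA.mem_accepts, DFA.eval, DFA.evalFrom_of_append, this]

end Regular

/-! ### Aperiodicity and the identity x^(n+1) = x^n -/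

section Aperiodic

/-- The power characterization of aperiodicity, with a uniform exponent. -/
def PowStable (M : Type v) [Monoid M] : Prop :=
  ∃ n : ℕ, ∀ x : M, x ^ (n + 1) = x ^ n

theorem pow_stable_of_le {M : Type v} [Monoid M] {x : M} {n m : ℕ} (h : x ^ (n + 1) = x ^ n)
    (hm : n ≤ m) : x ^ (m + 1) = x ^ m := by
  obtain ⟨k, rfl⟩ := Nat.exists_eq_add_of_le' hm
  rw [add_assoc, pow_add, h, ← pow_add]

theorem PowStable.isAperiodic {M : Type v} [Monoid M] (hM : PowStable M) : IsAperiodic M := by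
  obtain ⟨n, hn⟩ := hM
  rintro G ⟨e, he, hid, hinv⟩
  suffices h : ∀ g ∈ G, g = e from fun g hg h' hh' => (h g hg).trans (h h' hh').symm
  intro g hg
  obtain ⟨h, hh, -, hhg⟩ := hinv g hg
  -- The exponent starts at 1 because the zeroth power is the identity of M, which may differ from
  -- e.
  have key : ∀ k : ℕ, h ^ (k + 1) * g ^ (k + 1) = e := by
    intro k
    induction k with
    | zero => simpa using hhg
    | succ k ih =>
      calc h ^ (k + 1 + 1) * g ^ (k + 1 + 1)
          = h * (h ^ (k + 1) * g ^ (k + 1)) * g := by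
            rw [pow_succ' h, pow_succ g]; simp only [mul_assoc]
        _ = e := by rw [ih, (hid h hh).2, hhg]
  calc g = e * g := (hid g hg).1.symm
    _ = h ^ (n + 1) * g ^ (n + 1 + 1) := by rw [← key n, pow_succ g (n + 1), mul_assoc]
    _ = e := by rw [pow_stable_of_le (hn g) (Nat.le_succ n), key]

theorem exists_pow_isIdempotentElem {M : Type v} [Monoid M] [Finite M] (x : M) :
    ∃ k, IsIdempotentElem (x ^ (k + 1)) := by
  obtain ⟨i, j, hij, h⟩ : ∃ i j : ℕ, i < j ∧ x ^ i = x ^ j := by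
    obtain ⟨i, j, hne, h⟩ := Finite.exists_ne_map_eq_of_infinite fun n : ℕ => x ^ n
    rcases lt_or_gt_of_ne hne with h' | h'
    · exact ⟨i, j, h', h⟩
    · exact ⟨j, i, h', h.symm⟩
  obtain ⟨p, rfl⟩ := Nat.exists_eq_add_of_lt hij
  have key : ∀ q m : ℕ, i ≤ m → x ^ (m + q * (p + 1)) = x ^ m := by
    intro q m hm
    obtain ⟨r, rfl⟩ := Nat.exists_eq_add_of_le' hm
    induction q with
    | zero => simp
    | succ q ih =>
      rw [← ih]
      calc x ^ (r + i + (q + 1) * (p + 1)) = x ^ (r + q * (p + 1)) * x ^ (i + p + 1) := by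
            rw [← pow_add]; congr 1; ring
        _ = x ^ (r + i + q * (p + 1)) := by rw [← h, ← pow_add]; congr 1; ring
  -- The exponent (i + 1)(p + 1) is a multiple of the period p + 1 and at least the index i.
  refine ⟨i * (p + 1) + p, ?_⟩
  have hk : i * (p + 1) + p + 1 = (i + 1) * (p + 1) := by ring
  rw [IsIdempotentElem, ← pow_add, hk, key]
  nlinarith

/-- The powers of x from an idempotent one onwards form a group; its triviality identifies two
consecutive powers. Finiteness makes the exponent uniform. -/
theorem IsAperiodic.powStable {M : Type v} [Monoid M] [Finite M] (hM : IsAperiodic M) :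
    PowStable M := by
  have h1 : ∀ x : M, ∃ k : ℕ, x ^ (k + 1) = x ^ k := by
    intro x
    obtain ⟨k, hk⟩ := exists_pow_isIdempotentElem x
    have h2 : x ^ (k + 1) * x ^ (k + 1) = x ^ (k + 1) := hk
    let G : Subsemigroup M :=
      { carrier := {y | ∃ m, y = x ^ (k + 1 + m)}
        mul_mem' := by
          rintro _ _ ⟨m, rfl⟩ ⟨m', rfl⟩
          exact ⟨m + (k + 1 + m'), by rw [← pow_add, add_assoc]⟩ }
    have hG : IsGroupIn G := by
      refine ⟨x ^ (k + 1), ⟨0, rfl⟩, ?_, ?_⟩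
      · rintro _ ⟨m, rfl⟩
        constructor
        · rw [pow_add x (k + 1) m, ← mul_assoc, h2]
        · rw [add_comm (k + 1) m, pow_add x m (k + 1), mul_assoc, h2]
      · rintro _ ⟨m, rfl⟩
        -- The exponent of the inverse is chosen to make the total a multiple of k + 1, hence a
        -- power of the idempotent.
        have h3 : x ^ (k + 1 + m + (k + 1 + k * m)) = x ^ (k + 1) := by
          have : k + 1 + m + (k + 1 + k * m) = (k + 1) * (m + 1 + 1) := by ring
          rw [this, pow_mul, hk.pow_succ_eq]
        refine ⟨x ^ (k + 1 + k * m), ⟨_, rfl⟩, ?_, ?_⟩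
        · rw [← pow_add, h3]
        · rw [← pow_add, add_comm, h3]
    exact ⟨k + 1, hM G hG _ ⟨1, rfl⟩ _ ⟨0, rfl⟩⟩
  choose k hk using h1
  obtain ⟨n, hn⟩ := (Set.finite_range k).bddAbove
  exact ⟨n, fun x => pow_stable_of_le (hk x) (hn ⟨x, rfl⟩)⟩

variable {A : Type u}

theorem PowStable.syntacticMonoid {M : Type v} [Monoid M] (hM : PowStable M) {L : Language A}
    (hL : Recognizes M L) : PowStable (SyntacticMonoid L) := by
  obtain ⟨n, hn⟩ := hM
  obtain ⟨φ, X, h⟩ := hL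
  refine ⟨n, fun m => ?_⟩
  induction m using Con.induction_on with
  | H w =>
    refine (Con.eq (syntacticCon L) (a := w ^ (n + 1)) (b := w ^ n)).2 fun x y => ?_
    have h' : ∀ z : FreeMonoid A, z.toList ∈ L ↔ φ z ∈ X := fun z => h z.toList
    rw [h', h']
    simp only [map_mul, map_pow, hn]

theorem recognizes_syntacticMonoid (L : Language A) : Recognizes (SyntacticMonoid L) L := by
  refine ⟨(syntacticCon L).mk', {m | ∃ w : FreeMonoid A, w.toList ∈ L ∧ (syntacticCon L).mk' w = m},
    fun w => ⟨fun hw => ⟨_, hw, rfl⟩, ?_⟩⟩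
  rintro ⟨w', hw', h⟩
  simpa using ((Con.eq _).1 h 1 1).1 (by simpa using hw')

/-- Moves a recognizing monoid to an arbitrary universe by transporting its structure to a lifted
`Fin`. -/
theorem Recognizes.exists_small {M : Type u} [Monoid M] [Finite M] {L : Language A}
    (hL : Recognizes M L) (hM : PowStable M) :
    ∃ (N : Type v) (_ : Monoid N), Finite N ∧ IsAperiodic N ∧ Recognizes N L := by
  obtain ⟨N, ⟨e⟩⟩ : ∃ N : Type v, Nonempty (N ≃ M) :=
    ⟨ULift.{v} (Fin (Nat.card M)), ⟨Equiv.ulift.trans (Finite.equivFin M).symm⟩⟩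
  let _ : Monoid N := e.monoid
  let E : N ≃* M := e.mulEquiv
  refine ⟨N, inferInstance, Finite.of_equiv M e.symm, PowStable.isAperiodic ?_, ?_⟩
  · obtain ⟨n, hn⟩ := hM
    exact ⟨n, fun x => E.injective (by rw [map_pow, map_pow, hn])⟩
  · obtain ⟨φ, X, h⟩ := hL
    refine ⟨E.symm.toMonoidHom.comp φ, E ⁻¹' X, fun w => ?_⟩
    rw [h]
    simp

end Aperiodic

/-! ### From star-free expressions to first-order formulas -/

section StarFreeToFO

open FirstOrder.Language

variable {A : Type u}

/-- A property of words with `n` distinguished positions is definable if it is expressed by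
a formula of `FO(<)` with `n` variables. -/
def IsDefinable (n : ℕ) (P : ∀ w : List A, (Fin n → Dom w) → Prop) : Prop :=
  ∃ φ : (foLT A).BoundedFormula Empty n,
    ∀ (w : List A) (v : Fin n → Dom w), φ.Realize (default : Empty → Dom w) v ↔ P w v

namespace IsDefinable

variable {n : ℕ} {P Q : ∀ w : List A, (Fin n → Dom w) → Prop}

theorem congr (hP : IsDefinable n P) (h : ∀ w v, P w v ↔ Q w v) : IsDefinable n Q := by
  obtain ⟨φ, hφ⟩ := hP
  exact ⟨φ, fun w v => (hφ w v).trans (h w v)⟩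

theorem false : IsDefinable (A := A) n fun _ _ => False :=
  ⟨⊥, fun _ _ => BoundedFormula.realize_bot⟩

theorem not (hP : IsDefinable n P) : IsDefinable n fun w v => ¬ P w v := by
  obtain ⟨φ, hφ⟩ := hP
  exact ⟨φ.not, fun w v => BoundedFormula.realize_not.trans (not_congr (hφ w v))⟩

theorem and (hP : IsDefinable n P) (hQ : IsDefinable n Q) :
    IsDefinable n fun w v => P w v ∧ Q w v := by
  obtain ⟨φ, hφ⟩ := hP
  obtain ⟨ψ, hψ⟩ := hQ
  exact ⟨φ ⊓ ψ, fun w v => BoundedFormula.realize_inf.trans (and_congr (hφ w v) (hψ w v))⟩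

theorem or (hP : IsDefinable n P) (hQ : IsDefinable n Q) :
    IsDefinable n fun w v => P w v ∨ Q w v :=
  (hP.not.and hQ.not).not.congr fun w v => by tauto

theorem const (p : Prop) : IsDefinable (A := A) n fun _ _ => p := by
  by_cases h : p
  · exact false.not.congr fun _ _ => by simp [h]
  · exact false.congr fun _ _ => by simp [h]

theorem ex {R : ∀ w : List A, (Fin (n + 1) → Dom w) → Prop} (hR : IsDefinable (n + 1) R) :
    IsDefinable n fun w v => ∃ z : Dom w, R w (Fin.snoc v z) := by
  obtain ⟨φ, hφ⟩ := hR
  exact ⟨φ.ex, fun w v => BoundedFormula.realize_ex.trans (exists_congr fun z => hφ w _)⟩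

theorem all {R : ∀ w : List A, (Fin (n + 1) → Dom w) → Prop} (hR : IsDefinable (n + 1) R) :
    IsDefinable n fun w v => ∀ z : Dom w, R w (Fin.snoc v z) := by
  obtain ⟨φ, hφ⟩ := hR
  exact ⟨φ.all, fun w v => BoundedFormula.realize_all.trans (forall_congr' fun z => hφ w _)⟩

theorem eq (i j : Fin n) : IsDefinable (A := A) n fun _ v => v i = v j :=
  ⟨.equal (.var (.inr i)) (.var (.inr j)), fun _ _ => Iff.rfl⟩

theorem lt (i j : Fin n) : IsDefinable (A := A) n fun _ v => v i < v j :=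
  ⟨.rel (l := 2) (WordRel.lt : WordRel A 2) ![.var (.inr i), .var (.inr j)], fun _ _ => Iff.rfl⟩

theorem letter (a : A) (i : Fin n) : IsDefinable n fun w v => w.get (v i) = a :=
  ⟨.rel (l := 1) (WordRel.letter a : WordRel A 1) ![.var (.inr i)], fun _ _ => Iff.rfl⟩

end IsDefinable

/-- The start of an interval of positions, exclusive of the position that bounds it. -/
def lowerBound {w : List A} {n : ℕ} (v : Fin n → Dom w) (l : Option (Fin n)) : ℕ :=
  l.elim 0 fun i => v i + 1

/-- The end of an interval of positions, inclusive of the position that bounds it. -/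
def upperBound {w : List A} {n : ℕ} (v : Fin n → Dom w) (r : Option (Fin n)) : ℕ :=
  r.elim w.length fun i => v i + 1

/-- Position `i` belongs to the interval given by the bounds `l` and `r`. -/
theorem IsDefinable.mem_interval {n : ℕ} (l r : Option (Fin n)) (i : Fin n) :
    IsDefinable (A := A) n fun _ v => lowerBound v l ≤ v i ∧ (v i : ℕ) < upperBound v r := by
  refine .and ?_ ?_
  · cases l with
    | none => exact (const True).congr fun w v => by simp [lowerBound]
    | some j => exact (lt j i).congr fun w v => by simp [lowerBound]
  · cases r with
    | none => exact (const True).congr fun w v => by simp [upperBound]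
    | some j =>
      exact (lt j i).not.congr fun w v => by simp [upperBound]

theorem lowerBound_snoc {w : List A} {n : ℕ} (v : Fin n → Dom w) (z : Dom w)
    (l : Option (Fin n)) :
    lowerBound (Fin.snoc v z : Fin (n + 1) → Dom w) (l.map Fin.castSucc) = lowerBound v l := by
  cases l <;> simp [lowerBound]

theorem upperBound_snoc {w : List A} {n : ℕ} (v : Fin n → Dom w) (z : Dom w)
    (r : Option (Fin n)) :
    upperBound (Fin.snoc v z : Fin (n + 1) → Dom w) (r.map Fin.castSucc) = upperBound v r := by
  cases r <;> simp [upperBound]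

theorem upperBound_le {w : List A} {n : ℕ} (v : Fin n → Dom w) (r : Option (Fin n)) :
    upperBound v r ≤ w.length := by
  cases r with
  | none => exact le_rfl
  | some i => exact (v i).2

theorem drop_take_eq_singleton {w : List A} {l u : ℕ} (hu : u ≤ w.length) (a : A) :
    (w.take u).drop l = [a] ↔ ∃ z : Dom w, (l ≤ z ∧ (z : ℕ) < u) ∧ w.get z = a ∧
      ∀ y : Dom w, l ≤ y ∧ (y : ℕ) < u → y = z := by
  constructor
  · intro h
    have hl := congrArg List.length h
    simp only [List.length_drop, List.length_take, List.length_singleton] at hl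
    have h0 : ((w.take u).drop l)[0]? = some a := by rw [h]; rfl
    rw [List.getElem?_drop, List.getElem?_take_of_lt (by omega),
      List.getElem?_eq_getElem (by omega)] at h0
    refine ⟨⟨l, by omega⟩, ⟨le_rfl, by simp only; omega⟩, by simpa using h0, fun y hy => ?_⟩
    ext
    simp only
    omega
  · rintro ⟨z, ⟨h1, h2⟩, rfl, h⟩
    have hz := z.2
    have hl : l = z := by
      have := congrArg Fin.val (h ⟨l, by omega⟩ ⟨le_rfl, by simp only; omega⟩)
      simpa using this
    have hu' : u = z + 1 := by
      have := congrArg Fin.val (h ⟨u - 1, by omega⟩ ⟨by simp only; omega, by simp only; omega⟩)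
      simp only at this
      omega
    rw [hu', hl, List.take_succ_eq_append_getElem hz, List.drop_append_of_le_length (by simp),
      List.drop_eq_nil_of_le (by simp)]
    simp

/-- A cut is named by the position just before it. The cut at the left end has no such position
inside the interval, whence the separate case of the empty word in K. -/
theorem drop_take_mem_mul {w : List A} {l u : ℕ} (hu : u ≤ w.length) (K L : Language A) :
    (w.take u).drop l ∈ K * L ↔ ([] ∈ K ∧ (w.take u).drop l ∈ L) ∨
      ∃ z : Dom w, (l ≤ z ∧ (z : ℕ) < u) ∧ (w.take (z + 1)).drop l ∈ K ∧
        (w.take u).drop (z + 1) ∈ L := by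
  have h1 : ∀ z : ℕ, z < u → (w.take (z + 1)).drop l = ((w.take u).drop l).take (z + 1 - l) := by
    intro z hz
    rw [← List.drop_take, List.take_take, min_eq_left (by omega)]
  have h2 : ∀ z : ℕ, l ≤ z → (w.take u).drop (z + 1) = ((w.take u).drop l).drop (z + 1 - l) := by
    intro z hz
    rw [List.drop_drop]
    congr 1
    omega
  rw [Language.mem_mul]
  constructor
  · rintro ⟨a, ha, b, hb, h⟩
    have hl := congrArg List.length h
    simp only [List.length_drop, List.length_take, List.length_append] at hl
    rcases a with _ | ⟨c, a⟩
    · exact Or.inl ⟨ha, by rwa [← h]⟩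
    · right
      simp only [List.length_cons] at hl
      refine ⟨⟨l + a.length, by omega⟩, ⟨by simp, by simp only; omega⟩, ?_, ?_⟩
      · have hlen : l + a.length + 1 - l = (c :: a).length := by simp; omega
        rw [h1 _ (by simp only; omega), hlen, ← h, List.take_left]
        exact ha
      · have hlen : l + a.length + 1 - l = (c :: a).length := by simp; omega
        rw [h2 _ (by simp only; omega), hlen, ← h, List.drop_left]
        exact hb
  · rintro (⟨hK, hL⟩ | ⟨z, ⟨hz1, hz2⟩, hK, hL⟩)
    · exact ⟨[], hK, _, hL, rfl⟩
    · rw [h1 _ hz2] at hK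
      rw [h2 _ hz1] at hL
      exact ⟨_, hK, _, hL, List.take_append_drop _ _⟩

/-- Relativizing to factors lets the induction pass through products: the quantified cut becomes a
bound of both factors. The bound `none` stands for an end of the word, so no variable is needed for
the whole word. -/
theorem IsStarFree.isDefinable_factor {L : Language A} (hL : IsStarFree L) (n : ℕ)
    (l r : Option (Fin n)) :
    IsDefinable n fun w v => (w.take (upperBound v r)).drop (lowerBound v l) ∈ L := by
  induction hL generalizing n with
  | empty => exact IsDefinable.false.congr fun _ _ => by simp
  | letter a =>
    have h := ((IsDefinable.mem_interval (A := A) (l.map Fin.castSucc) (r.map Fin.castSucc)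
      (Fin.last n)).and ((IsDefinable.letter a (Fin.last n)).and
      ((IsDefinable.mem_interval ((l.map Fin.castSucc).map Fin.castSucc)
        ((r.map Fin.castSucc).map Fin.castSucc) (Fin.last (n + 1))).not.or
        (IsDefinable.eq (Fin.last (n + 1)) (Fin.last n).castSucc)).all)).ex
    refine h.congr fun w v => ?_
    simp only [lowerBound_snoc, upperBound_snoc, Fin.snoc_last, Fin.snoc_castSucc]
    refine Iff.trans ?_ (drop_take_eq_singleton (upperBound_le v r) a).symm
    simp only [imp_iff_not_or]
  | union _ _ hK hL => exact (hK n l r).or (hL n l r)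
  | @product K L _ _ hK hL =>
    have h := ((IsDefinable.const ([] ∈ K)).and (hL n l r)).or
      ((IsDefinable.mem_interval (l.map Fin.castSucc) (r.map Fin.castSucc) (Fin.last n)).and
        ((hK (n + 1) (l.map Fin.castSucc) (some (Fin.last n))).and
          (hL (n + 1) (some (Fin.last n)) (r.map Fin.castSucc)))).ex
    refine h.congr fun w v => ?_
    rw [drop_take_mem_mul (upperBound_le v r)]
    simp only [lowerBound_snoc, upperBound_snoc, Fin.snoc_last]
    simp only [lowerBound, upperBound, Option.elim_some, Fin.snoc_last]
  | inter _ _ hK hL => exact (hK n l r).and (hL n l r)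
  | compl _ hL => exact (hL n l r).not

theorem IsStarFree.isFODefinable {L : Language A} (hL : IsStarFree L) : IsFODefinable L := by
  obtain ⟨φ, hφ⟩ := hL.isDefinable_factor 0 none none
  refine ⟨φ, ?_⟩
  ext w
  refine (hφ w default).trans ?_
  simp [lowerBound, upperBound]

end StarFreeToFO

/-! ### From first-order formulas to aperiodic monoids -/

section FOToAperiodic

open FirstOrder.Language

/-- The carrier of the monoid used for quantification: a monoid element together with a set of
monoid elements. -/
@[ext]
structure PowersetProduct (M : Type v) where
  fst : M
  snd : Set M

namespace PowersetProduct

variable {M : Type v} [Monoid M]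

instance : Mul (PowersetProduct M) where
  mul x y := ⟨x.fst * y.fst, {m | (∃ s ∈ x.snd, m = s * y.fst) ∨ ∃ s ∈ y.snd, m = x.fst * s}⟩

instance : One (PowersetProduct M) where
  one := ⟨1, ∅⟩

theorem fst_mul (x y : PowersetProduct M) : (x * y).fst = x.fst * y.fst := rfl

theorem mem_snd_mul {x y : PowersetProduct M} {m : M} :
    m ∈ (x * y).snd ↔ (∃ s ∈ x.snd, m = s * y.fst) ∨ ∃ s ∈ y.snd, m = x.fst * s := Iff.rfl

theorem fst_one : (1 : PowersetProduct M).fst = 1 := rfl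

theorem snd_one : (1 : PowersetProduct M).snd = ∅ := rfl

instance : Monoid (PowersetProduct M) where
  mul_assoc x y z := by
    refine PowersetProduct.ext (mul_assoc _ _ _) (Set.ext fun m => ?_)
    simp only [mem_snd_mul, fst_mul]
    constructor
    · rintro (⟨s, ⟨t, ht, rfl⟩ | ⟨t, ht, rfl⟩, rfl⟩ | ⟨s, hs, rfl⟩)
      · exact Or.inl ⟨t, ht, mul_assoc _ _ _⟩
      · exact Or.inr ⟨_, Or.inl ⟨t, ht, rfl⟩, mul_assoc _ _ _⟩
      · exact Or.inr ⟨_, Or.inr ⟨s, hs, rfl⟩, mul_assoc _ _ _⟩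
    · rintro (⟨s, hs, rfl⟩ | ⟨s, ⟨t, ht, rfl⟩ | ⟨t, ht, rfl⟩, rfl⟩)
      · exact Or.inl ⟨_, Or.inl ⟨s, hs, rfl⟩, (mul_assoc _ _ _).symm⟩
      · exact Or.inl ⟨_, Or.inr ⟨t, ht, rfl⟩, (mul_assoc _ _ _).symm⟩
      · exact Or.inr ⟨t, ht, (mul_assoc _ _ _).symm⟩
  one_mul x := PowersetProduct.ext (one_mul _) (Set.ext fun m => by
    simp [mem_snd_mul, fst_one, snd_one])
  mul_one x := PowersetProduct.ext (mul_one _) (Set.ext fun m => by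
    simp [mem_snd_mul, fst_one, snd_one])

instance [Finite M] : Finite (PowersetProduct M) :=
  Finite.of_injective (fun x => (x.fst, x.snd)) fun x y h => by
    simp only [Prod.mk.injEq] at h
    exact PowersetProduct.ext h.1 h.2

theorem fst_pow (x : PowersetProduct M) (k : ℕ) : (x ^ k).fst = x.fst ^ k := by
  induction k with
  | zero => simp [fst_one]
  | succ k ih => rw [pow_succ, pow_succ, fst_mul, ih]

theorem mem_snd_pow {x : PowersetProduct M} {k : ℕ} {m : M} :
    m ∈ (x ^ k).snd ↔ ∃ i j : ℕ, i + j + 1 = k ∧ ∃ s ∈ x.snd, m = x.fst ^ i * s * x.fst ^ j := by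
  induction k generalizing m with
  | zero => simp [snd_one]
  | succ k ih =>
    rw [pow_succ, mem_snd_mul, fst_pow]
    constructor
    · rintro (⟨t, ht, rfl⟩ | ⟨s, hs, rfl⟩)
      · obtain ⟨i, j, hij, s, hs, rfl⟩ := ih.1 ht
        exact ⟨i, j + 1, by omega, s, hs, by simp only [mul_assoc, pow_succ]⟩
      · exact ⟨k, 0, by omega, s, hs, by simp⟩
    · rintro ⟨i, j, hij, s, hs, rfl⟩
      rcases j with _ | j
      · exact Or.inr ⟨s, hs, by simp [show i = k by omega]⟩
      · exact Or.inl ⟨_, ih.2 ⟨i, j, by omega, s, hs, rfl⟩, by simp only [mul_assoc, pow_succ]⟩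

/-- Second components of powers consist of elements x^i s x^j. Once i + j is at least 2n, one
exponent is large enough to be changed by one without effect. -/
theorem powStable (hM : PowStable M) : PowStable (PowersetProduct M) := by
  obtain ⟨n, hn⟩ := hM
  refine ⟨2 * n + 1, fun x => PowersetProduct.ext ?_ (Set.ext fun m => ?_)⟩
  · rw [fst_pow, fst_pow]
    exact pow_stable_of_le (hn _) (by omega)
  · rw [mem_snd_pow, mem_snd_pow]
    have h : ∀ i, n ≤ i → x.fst ^ (i + 1) = x.fst ^ i := fun i => pow_stable_of_le (hn _)
    constructor
    · rintro ⟨i, j, hij, s, hs, rfl⟩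
      by_cases hi : n + 1 ≤ i
      · obtain ⟨i, rfl⟩ := Nat.exists_eq_add_of_le' (show 1 ≤ i by omega)
        exact ⟨i, j, by omega, s, hs, by rw [h i (by omega)]⟩
      · obtain ⟨j, rfl⟩ := Nat.exists_eq_add_of_le' (show 1 ≤ j by omega)
        exact ⟨i, j, by omega, s, hs, by rw [h j (by omega)]⟩
    · rintro ⟨i, j, hij, s, hs, rfl⟩
      by_cases hi : n ≤ i
      · exact ⟨i + 1, j, by omega, s, hs, by rw [h i hi]⟩
      · exact ⟨i, j + 1, by omega, s, hs, by rw [h j (by omega)]⟩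

/-- The second component tries every way of marking exactly one position, which is what an
existential quantifier needs. -/
theorem prod_ofFn {k : ℕ} (p q : Fin k → M) :
    (List.ofFn fun i => (⟨p i, {q i}⟩ : PowersetProduct M)).prod =
      ⟨(List.ofFn p).prod, {m | ∃ z, m = (List.ofFn (Function.update p z (q z))).prod}⟩ := by
  induction k with
  | zero => simp; rfl
  | succ k ih =>
    rw [List.ofFn_succ, List.prod_cons, ih]
    refine PowersetProduct.ext (by simp [fst_mul, List.ofFn_succ]) (Set.ext fun m => ?_)
    have h0 : ∀ i : Fin k, Function.update p 0 (q 0) i.succ = p i.succ := fun i =>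
      Function.update_of_ne (Fin.succ_ne_zero i) _ _
    have h1 : ∀ z i : Fin k, Function.update p z.succ (q z.succ) i.succ =
        Function.update (fun i => p i.succ) z (q z.succ) i := by
      intro z i
      by_cases h : i = z
      · subst h; simp
      · rw [Function.update_of_ne (by simpa using h), Function.update_of_ne h]
    have h2 : ∀ z : Fin k, Function.update p z.succ (q z.succ) 0 = p 0 := fun z =>
      Function.update_of_ne (Fin.succ_ne_zero z).symm _ _
    simp only [mem_snd_mul, Set.mem_ofPred_eq, Fin.exists_fin_succ, List.ofFn_succ, List.prod_cons,
      h0, h1, h2, Function.update_self, Set.mem_singleton_iff, exists_eq_left]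
    refine or_congr Iff.rfl ⟨?_, ?_⟩
    · rintro ⟨_, ⟨z, rfl⟩, rfl⟩
      exact ⟨z, rfl⟩
    · rintro ⟨z, rfl⟩
      exact ⟨_, ⟨z, rfl⟩, rfl⟩

end PowersetProduct

/-- The monoid that detects in a word a position of a first kind, a position of a second kind, and
one of the first kind before one of the second kind. -/
@[ext]
structure OrderDetector where
  fst : Prop
  snd : Prop
  both : Prop

namespace OrderDetector

instance : Mul OrderDetector where
  mul x y := ⟨x.fst ∨ y.fst, x.snd ∨ y.snd, x.both ∨ y.both ∨ (x.fst ∧ y.snd)⟩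

instance : One OrderDetector where
  one := ⟨False, False, False⟩

theorem mul_def (x y : OrderDetector) :
    x * y = ⟨x.fst ∨ y.fst, x.snd ∨ y.snd, x.both ∨ y.both ∨ (x.fst ∧ y.snd)⟩ := rfl

theorem one_def : (1 : OrderDetector) = ⟨False, False, False⟩ := rfl

instance : Monoid OrderDetector where
  mul_assoc x y z := by
    simp only [mul_def, mk.injEq, eq_iff_iff]
    tauto
  one_mul x := by simp [mul_def, one_def]
  mul_one x := by simp [mul_def, one_def]

instance : Finite OrderDetector :=
  Finite.of_injective (fun x => (x.fst, x.snd, x.both)) fun x y h => by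
    simp only [Prod.mk.injEq] at h
    exact OrderDetector.ext h.1 h.2.1 h.2.2

theorem powStable : PowStable OrderDetector := by
  -- Squaring may newly create the pattern `both`; a further factor adds nothing.
  refine ⟨2, fun x => ?_⟩
  simp only [pow_succ, pow_zero, one_mul, mul_def, mk.injEq, eq_iff_iff]
  tauto

theorem prod_ofFn {k : ℕ} (p q : Fin k → Prop) :
    (List.ofFn fun i => (⟨p i, q i, False⟩ : OrderDetector)).prod =
      ⟨∃ i, p i, ∃ i, q i, ∃ i j, i < j ∧ p i ∧ q j⟩ := by
  induction k with
  | zero => simp [one_def]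
  | succ k ih =>
    rw [List.ofFn_succ, List.prod_cons, ih]
    simp only [mul_def, mk.injEq, Fin.exists_fin_succ, eq_iff_iff, false_or, Fin.succ_lt_succ_iff,
      Fin.succ_pos, Fin.not_lt_zero, false_and, true_and, exists_and_left]
    exact or_comm

end OrderDetector

variable {A : Type u}

/-- A property of words with `n` distinguished positions is aperiodic if it is recognized by
a finite aperiodic monoid, where each letter is expanded by the variables placed at it. -/
def IsAperiodicProperty (n : ℕ) (P : ∀ w : List A, (Fin n → Dom w) → Prop) : Prop :=
  ∃ (M : Type) (_ : Monoid M), Finite M ∧ PowStable M ∧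
    ∃ (f : A → (Fin n → Prop) → M) (X : Set M), ∀ (w : List A) (v : Fin n → Dom w),
      P w v ↔ (List.ofFn fun i : Fin w.length => f (w.get i) fun j => v j = i).prod ∈ X

namespace IsAperiodicProperty

variable {n : ℕ} {P Q : ∀ w : List A, (Fin n → Dom w) → Prop}

theorem false : IsAperiodicProperty (A := A) n fun _ _ => False :=
  ⟨OrderDetector, inferInstance, inferInstance, OrderDetector.powStable, fun _ _ => 1, ∅,
    fun _ _ => by simp⟩

theorem not (hP : IsAperiodicProperty n P) : IsAperiodicProperty n fun w v => ¬ P w v := by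
  obtain ⟨M, _, _, hM, f, X, h⟩ := hP
  exact ⟨M, _, ‹_›, hM, f, Xᶜ, fun w v => not_congr (h w v)⟩

theorem imp (hP : IsAperiodicProperty n P) (hQ : IsAperiodicProperty n Q) :
    IsAperiodicProperty n fun w v => P w v → Q w v := by
  obtain ⟨M, _, _, ⟨k, hM⟩, f, X, hX⟩ := hP
  obtain ⟨N, _, _, ⟨l, hN⟩, g, Y, hY⟩ := hQ
  refine ⟨M × N, inferInstance, inferInstance, ⟨k + l, fun x => ?_⟩, fun a s => (f a s, g a s),
    {x | x.1 ∈ X → x.2 ∈ Y}, fun w v => ?_⟩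
  · exact Prod.ext (pow_stable_of_le (hM x.1) (by omega)) (pow_stable_of_le (hN x.2) (by omega))
  · dsimp only
    rw [hX, hY, Set.mem_ofPred_eq, ← MonoidHom.coe_fst, ← MonoidHom.coe_snd, map_list_prod,
      map_list_prod, List.map_ofFn, List.map_ofFn]
    rfl

theorem ex {R : ∀ w : List A, (Fin (n + 1) → Dom w) → Prop} (hR : IsAperiodicProperty (n + 1) R) :
    IsAperiodicProperty n fun w v => ∃ z : Dom w, R w (Fin.snoc v z) := by
  obtain ⟨M, _, _, hM, f, X, h⟩ := hR
  -- Each letter carries its value without the quantified variable and, as a singleton, its value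
  -- with it.
  refine ⟨PowersetProduct M, inferInstance, inferInstance, PowersetProduct.powStable hM,
    fun a s => ⟨f a (Fin.snoc (α := fun _ => Prop) s False),
      {f a (Fin.snoc (α := fun _ => Prop) s True)}⟩,
    {x | (x.snd ∩ X).Nonempty}, fun w v => ?_⟩
  rw [PowersetProduct.prod_ofFn]
  have key : ∀ z : Dom w, (fun i : Fin w.length => f (w.get i)
      fun j => (Fin.snoc v z : Fin (n + 1) → Dom w) j = i) =
      Function.update (fun i : Fin w.length => f (w.get i)
        (Fin.snoc (α := fun _ => Prop) (fun j => v j = i) False)) z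
        (f (w.get z) (Fin.snoc (α := fun _ => Prop) (fun j => v j = z) True)) := by
    intro z
    funext i
    have hs : (fun j => (Fin.snoc v z : Fin (n + 1) → Dom w) j = i) =
        Fin.snoc (α := fun _ => Prop) (fun j => v j = i) (z = i) := by
      funext j
      refine Fin.lastCases ?_ (fun j => ?_) j <;> simp
    rw [hs]
    by_cases hz : i = z
    · subst hz; simp
    · rw [Function.update_of_ne hz]
      simp [Ne.symm hz]
  simp only [h, key]
  constructor
  · rintro ⟨z, hz⟩
    exact ⟨_, ⟨z, rfl⟩, hz⟩
  · rintro ⟨_, ⟨z, rfl⟩, hz⟩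
    exact ⟨z, hz⟩

theorem congr (hP : IsAperiodicProperty n P) (h : ∀ w v, P w v ↔ Q w v) :
    IsAperiodicProperty n Q := by
  have : P = Q := by
    funext w v
    exact propext (h w v)
  exact this ▸ hP

theorem all {R : ∀ w : List A, (Fin (n + 1) → Dom w) → Prop}
    (hR : IsAperiodicProperty (n + 1) R) :
    IsAperiodicProperty n fun w v => ∀ z : Dom w, R w (Fin.snoc v z) :=
  hR.not.ex.not.congr fun w v => by simp

theorem eq (i j : Fin n) : IsAperiodicProperty (A := A) n fun _ v => v i = v j := by
  refine ⟨OrderDetector, inferInstance, inferInstance, OrderDetector.powStable,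
    fun _ s => ⟨s i ∧ s j, False, False⟩, {x | x.fst}, fun w v => ?_⟩
  rw [OrderDetector.prod_ofFn]
  simp [eq_comm]

theorem letter (a : A) (i : Fin n) : IsAperiodicProperty n fun w v => w.get (v i) = a := by
  refine ⟨OrderDetector, inferInstance, inferInstance, OrderDetector.powStable,
    fun b s => ⟨b = a ∧ s i, False, False⟩, {x | x.fst}, fun w v => ?_⟩
  rw [OrderDetector.prod_ofFn]
  simp

theorem lt (i j : Fin n) : IsAperiodicProperty (A := A) n fun _ v => v i < v j := by
  refine ⟨OrderDetector, inferInstance, inferInstance, OrderDetector.powStable,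
    fun _ s => ⟨s i, s j, False⟩, {x | x.both}, fun w v => ?_⟩
  rw [OrderDetector.prod_ofFn]
  simp

end IsAperiodicProperty

theorem exists_realize_term_eq {n : ℕ} (t : (foLT A).Term (Empty ⊕ Fin n)) :
    ∃ i : Fin n, ∀ (w : List A) (v : Fin n → Dom w),
      t.realize (Sum.elim (default : Empty → Dom w) v) = v i := by
  cases t with
  | var x =>
    rcases x with x | i
    · exact x.elim
    · exact ⟨i, fun _ _ => rfl⟩
  | func f _ => exact Empty.elim f

theorem isAperiodicProperty_realize {n : ℕ} (φ : (foLT A).BoundedFormula Empty n) :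
    IsAperiodicProperty (A := A) n fun w v => φ.Realize (M := Dom w) default v := by
  induction φ with
  | falsum => exact .false
  | equal t₁ t₂ =>
    obtain ⟨i, hi⟩ := exists_realize_term_eq t₁
    obtain ⟨j, hj⟩ := exists_realize_term_eq t₂
    exact (IsAperiodicProperty.eq i j).congr fun w v => by
      simp only [BoundedFormula.Realize, hi, hj]
  | rel R ts =>
    cases R with
    | lt =>
      obtain ⟨i, hi⟩ := exists_realize_term_eq (ts 0)
      obtain ⟨j, hj⟩ := exists_realize_term_eq (ts 1)
      refine (IsAperiodicProperty.lt i j).congr fun w v => ?_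
      rw [← hi w v, ← hj w v]
      rfl
    | letter a =>
      obtain ⟨i, hi⟩ := exists_realize_term_eq (ts 0)
      refine (IsAperiodicProperty.letter a i).congr fun w v => ?_
      rw [← hi w v]
      rfl
  | imp _ _ h₁ h₂ => exact h₁.imp h₂
  | all _ h => exact h.all

theorem IsFODefinable.powStable_syntacticMonoid {L : Language A} (hL : IsFODefinable L) :
    PowStable (SyntacticMonoid L) := by
  obtain ⟨φ, rfl⟩ := hL
  obtain ⟨M, _, _, hM, f, X, h⟩ := isAperiodicProperty_realize φ
  refine hM.syntacticMonoid ⟨FreeMonoid.lift fun a => f a default, X, fun w => ?_⟩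
  refine (h w default).trans ?_
  rw [FreeMonoid.lift_apply, FreeMonoid.toList_ofList]
  -- Without variables the marking is trivial, so the letter values define a morphism on words.
  have : (List.ofFn fun i : Fin w.length => f (w.get i) fun j => (default : Fin 0 → Dom w) j = i) =
      w.map fun a => f a default := by
    conv_rhs => rw [← List.ofFn_get w, List.map_ofFn]
    congr 1
    funext i
    exact congrArg _ (Subsingleton.elim _ _)
  rw [this]

end FOToAperiodic

/-! ### Local divisors -/

section LocalDivisor

variable {M : Type u} [Monoid M]

/-- The local divisor of a monoid `M` at `c`: the set `cM ∩ Mc` with the product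
`ac ∘ cb = acb`. -/
def LocalDivisor (c : M) : Type u :=
  {x : M // (∃ a, x = a * c) ∧ ∃ b, x = c * b}

namespace LocalDivisor

variable {c : M}

/-- Makes the product independent of the chosen left cofactor. -/
theorem mul_eq_mul {a a' y : M} (h : a * c = a' * c) (hy : ∃ b, y = c * b) : a * y = a' * y := by
  obtain ⟨b, rfl⟩ := hy
  rw [← mul_assoc, h, mul_assoc]

noncomputable instance : Mul (LocalDivisor c) where
  mul x y := ⟨x.2.1.choose * y.1, by
    constructor
    · obtain ⟨b, hb⟩ := y.2.1
      exact ⟨x.2.1.choose * b, by rw [hb, mul_assoc]⟩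
    · obtain ⟨b, hb⟩ := y.2.2
      obtain ⟨d, hd⟩ := x.2.2
      refine ⟨d * b, ?_⟩
      rw [hb, ← mul_assoc, ← x.2.1.choose_spec, hd, mul_assoc]⟩

instance : One (LocalDivisor c) where
  one := ⟨c, ⟨1, (one_mul c).symm⟩, 1, (mul_one c).symm⟩

theorem val_one : (1 : LocalDivisor c).1 = c := rfl

theorem val_mul {x : LocalDivisor c} {a : M} (hx : x.1 = a * c) (y : LocalDivisor c) :
    (x * y).1 = a * y.1 :=
  mul_eq_mul (x.2.1.choose_spec.symm.trans hx) y.2.2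

noncomputable instance : Monoid (LocalDivisor c) where
  mul_assoc x y z := by
    obtain ⟨a, ha⟩ := x.2.1
    obtain ⟨b, hb⟩ := y.2.1
    have hxy : (x * y).1 = a * b * c := by rw [val_mul ha, hb, mul_assoc]
    exact Subtype.ext (by rw [val_mul hxy, val_mul ha, val_mul hb, mul_assoc])
  one_mul x := Subtype.ext (by rw [val_mul (by rw [val_one, one_mul]), one_mul])
  mul_one x := by
    obtain ⟨a, ha⟩ := x.2.1
    exact Subtype.ext (by rw [val_mul ha, val_one, ha])

instance [Finite M] : Finite (LocalDivisor c) := Subtype.finite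

theorem val_pow {x : LocalDivisor c} {a : M} (hx : x.1 = a * c) (k : ℕ) :
    (x ^ k).1 = a ^ k * c := by
  induction k with
  | zero => rw [pow_zero, pow_zero, one_mul, val_one]
  | succ k ih => rw [pow_succ', val_mul hx, ih, pow_succ', mul_assoc]

theorem powStable (hM : PowStable M) (c : M) : PowStable (LocalDivisor c) := by
  obtain ⟨n, hn⟩ := hM
  refine ⟨n, fun x => ?_⟩
  obtain ⟨a, ha⟩ := x.2.1
  exact Subtype.ext (by rw [val_pow ha, val_pow ha, hn])

/-- The local divisor misses 1: if 1 = ac then a^k c^k = 1 for all k, and c^(n+1) = c^n forces c =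
1. -/
theorem card_lt [Finite M] (hM : PowStable M) (hc : c ≠ 1) :
    Nat.card (LocalDivisor c) < Nat.card M := by
  refine Finite.card_subtype_lt (x := 1) ?_
  rintro ⟨⟨a, ha⟩, -⟩
  obtain ⟨n, hn⟩ := hM
  refine hc ?_
  have h : ∀ k : ℕ, a ^ k * c ^ k = 1 := by
    intro k
    induction k with
    | zero => simp
    | succ k ih =>
      calc a ^ (k + 1) * c ^ (k + 1) = a ^ k * (a * c) * c ^ k := by
            rw [pow_succ, pow_succ']; simp only [mul_assoc]
        _ = 1 := by rw [← ha, mul_one, ih]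
  calc c = a ^ n * c ^ n * c := by rw [h, one_mul]
    _ = a ^ n * c ^ (n + 1) := by rw [pow_succ, mul_assoc]
    _ = 1 := by rw [hn, h]

/-- The element `c t c` of the local divisor at `c`. -/
def sandwich (c t : M) : LocalDivisor c :=
  ⟨c * t * c, ⟨c * t, rfl⟩, t * c, mul_assoc _ _ _⟩

/-- Neighbouring factors share one c, so the product in the local divisor evaluates c t₁ c t₂ ⋯ c in
M. -/
theorem val_prod_sandwich (m : List M) :
    ((m.map (sandwich c)).prod).1 = (m.map (c * ·)).prod * c := by
  induction m with
  | nil => simp [val_one]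
  | cons t m ih =>
    rw [List.map_cons, List.prod_cons, val_mul (a := c * t) rfl, ih, List.map_cons, List.prod_cons,
      mul_assoc (c * t)]

end LocalDivisor

end LocalDivisor

/-! ### Closure properties of star-free languages -/

section StarFreeClosure

variable {A : Type u}

/-- The language of the words with a given property. -/
def languageOf (P : List A → Prop) : Language A := {w | P w}

namespace IsStarFree

theorem congr {K L : Language A} (hK : IsStarFree K) (h : ∀ w, w ∈ K ↔ w ∈ L) : IsStarFree L :=
  Language.ext h ▸ hK

theorem univ : IsStarFree (languageOf fun _ : List A => True) :=
  empty.compl.congr fun _ => ⟨fun _ => trivial, fun _ h => h⟩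

theorem iUnion {ι : Type*} [Finite ι] {L : ι → Language A} (h : ∀ i, IsStarFree (L i)) :
    IsStarFree (languageOf fun w => ∃ i, w ∈ L i) := by
  have key : ∀ s : Set ι, s.Finite → IsStarFree (languageOf fun w => ∃ i ∈ s, w ∈ L i) := by
    intro s hs
    induction s, hs using Set.Finite.induction_on with
    | empty => exact empty.congr fun w => ⟨False.elim, fun ⟨i, hi, _⟩ => hi⟩
    | @insert a s _ _ ih =>
      refine ((h a).union ih).congr fun w => ⟨?_, ?_⟩
      · rintro (h | ⟨i, hi, h⟩)
        · exact ⟨a, Or.inl rfl, h⟩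
        · exact ⟨i, Or.inr hi, h⟩
      · rintro ⟨i, rfl | hi, h⟩
        · exact Or.inl h
        · exact Or.inr ⟨i, hi, h⟩
  exact (key _ Set.finite_univ).congr fun w =>
    ⟨fun ⟨i, _, h⟩ => ⟨i, h⟩, fun ⟨i, h⟩ => ⟨i, trivial, h⟩⟩

theorem cons_univ (a : A) : IsStarFree (languageOf fun w => ∃ x, w = a :: x) := by
  refine ((letter a).product univ).congr fun w => ?_
  rw [Language.mem_mul]
  constructor
  · rintro ⟨_, rfl, x, -, rfl⟩
    exact ⟨x, rfl⟩
  · rintro ⟨x, rfl⟩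
    exact ⟨[a], rfl, x, trivial, rfl⟩

variable [Finite A]

/-- Complement of the finite union of the languages A* a A* over the letters a outside B. -/
theorem sublists (B : Set A) : IsStarFree (languageOf fun w => ∀ a ∈ w, a ∈ B) := by
  have h : ∀ a : ↥Bᶜ, IsStarFree
      (languageOf (fun _ => True) * languageOf fun w => ∃ x, w = a.1 :: x) := fun a =>
    univ.product (cons_univ a.1)
  refine (iUnion h).compl.congr fun w => ?_
  change (¬ ∃ a : ↥Bᶜ, w ∈
    (languageOf (fun _ => True) * languageOf fun w => ∃ x, w = a.1 :: x)) ↔ ∀ a ∈ w, a ∈ B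
  constructor
  · intro hw a ha
    by_contra haB
    obtain ⟨s, t, rfl⟩ := List.append_of_mem ha
    exact hw ⟨⟨a, haB⟩, Language.append_mem_mul trivial ⟨t, rfl⟩⟩
  · rintro hw ⟨⟨a, ha⟩, h⟩
    obtain ⟨s, -, _, ⟨t, rfl⟩, rfl⟩ := Language.mem_mul.1 h
    exact ha (hw a (by simp))

theorem one : IsStarFree (1 : Language A) :=
  (sublists (∅ : Set A)).congr fun w => by
    change (∀ a ∈ w, a ∈ (∅ : Set A)) ↔ w = []
    simp [List.eq_nil_iff_forall_not_mem]

end IsStarFree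

end StarFreeClosure

/-! ### Schützenberger's theorem -/

section Schutzenberger

variable {A : Type u} {M : Type u} [Monoid M]

open Classical in
/-- Write a word as `v₀ c v₁ ⋯ c vₖ` with no `c` in the `vᵢ`; this is the value of `v₀` together
with the list of the values of `v₁, …, vₖ`. -/
noncomputable def blockValues (f : A → M) (c : A) : List A → M × List M
  | [] => (1, [])
  | a :: w =>
    if a = c then (1, (blockValues f c w).1 :: (blockValues f c w).2)
    else (f a * (blockValues f c w).1, (blockValues f c w).2)

variable {f : A → M} {c : A}

theorem blockValues_cons_self (w : List A) :
    blockValues f c (c :: w) = (1, (blockValues f c w).1 :: (blockValues f c w).2) := by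
  simp [blockValues]

theorem blockValues_cons_of_ne {a : A} (h : a ≠ c) (w : List A) :
    blockValues f c (a :: w) = (f a * (blockValues f c w).1, (blockValues f c w).2) := by
  simp [blockValues, h]

/-- The words that are empty or start with the letter `c`. -/
def StartsWith (c : A) (w : List A) : Prop := w = [] ∨ ∃ x, w = c :: x

theorem StartsWith.of_append {x y : List A} (h : StartsWith c (x ++ y)) : StartsWith c x := by
  rcases x with _ | ⟨a, x⟩
  · exact Or.inl rfl
  · rcases h with h | ⟨z, h⟩
    · simp at h
    · simp only [List.cons_append, List.cons.injEq] at h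
      exact Or.inr ⟨x, by rw [h.1]⟩

theorem StartsWith.append {x y : List A} (hx : StartsWith c x) (hy : StartsWith c y) :
    StartsWith c (x ++ y) := by
  rcases hx with rfl | ⟨x, rfl⟩
  · simpa using hy
  · exact Or.inr ⟨x ++ y, rfl⟩

theorem StartsWith.blockValues_fst {w : List A} (h : StartsWith c w) :
    (blockValues f c w).1 = 1 := by
  rcases h with rfl | ⟨x, rfl⟩
  · rfl
  · rw [blockValues_cons_self]

/-- Since y is empty or starts with c, it does not prolong the last block of x. -/
theorem blockValues_append (x : List A) {y : List A} (hy : StartsWith c y) :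
    blockValues f c (x ++ y) =
      ((blockValues f c x).1, (blockValues f c x).2 ++ (blockValues f c y).2) := by
  induction x with
  | nil => exact Prod.ext hy.blockValues_fst rfl
  | cons a x ih =>
    rw [List.cons_append]
    by_cases h : a = c
    · subst h
      rw [blockValues_cons_self, blockValues_cons_self, ih]
      rfl
    · rw [blockValues_cons_of_ne h, blockValues_cons_of_ne h, ih]

/-- A cut of the list of values lifts to a cut of the word just before some c or at its end; this
makes preimages commute with products. -/
theorem exists_append_of_blockValues_snd {w : List A} {m₁ m₂ : List M}
    (h : (blockValues f c w).2 = m₁ ++ m₂) :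
    ∃ x y, w = x ++ y ∧ StartsWith c y ∧ (blockValues f c x).2 = m₁ ∧
      (blockValues f c y).2 = m₂ := by
  induction w generalizing m₁ with
  | nil =>
    obtain ⟨rfl, rfl⟩ := List.append_eq_nil_iff.1 h.symm
    exact ⟨[], [], rfl, Or.inl rfl, rfl, rfl⟩
  | cons a w ih =>
    by_cases ha : a = c
    · subst ha
      rcases m₁ with _ | ⟨t, m₁⟩
      · exact ⟨[], a :: w, rfl, Or.inr ⟨w, rfl⟩, rfl, h⟩
      · rw [blockValues_cons_self] at h
        simp only [List.cons_append, List.cons.injEq] at h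
        obtain ⟨x, y, rfl, hy, hx', hy'⟩ := ih h.2
        refine ⟨a :: x, y, rfl, hy, ?_, hy'⟩
        rw [blockValues_cons_self, hx', ← h.1, blockValues_append x hy]
    · rw [blockValues_cons_of_ne ha] at h
      obtain ⟨x, y, rfl, hy, hx', hy'⟩ := ih h
      exact ⟨a :: x, y, rfl, hy, by rw [blockValues_cons_of_ne ha, hx'], hy'⟩

theorem blockValues_of_notMem {w : List A} (h : c ∉ w) :
    blockValues f c w = ((w.map f).prod, []) := by
  induction w with
  | nil => rfl
  | cons a w ih =>
    simp only [List.mem_cons, not_or] at h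
    rw [blockValues_cons_of_ne (Ne.symm h.1), ih h.2]
    rfl

theorem notMem_of_blockValues_snd {w : List A} (h : (blockValues f c w).2 = []) : c ∉ w := by
  intro hc
  obtain ⟨x, y, rfl⟩ := List.append_of_mem hc
  rw [blockValues_append x (Or.inr ⟨y, rfl⟩), blockValues_cons_self] at h
  simp at h

theorem prod_map_eq_blockValues (w : List A) :
    (w.map f).prod =
      (blockValues f c w).1 * ((blockValues f c w).2.map (f c * ·)).prod := by
  induction w with
  | nil => simp [blockValues]
  | cons a w ih =>
    rw [List.map_cons, List.prod_cons, ih]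
    by_cases ha : a = c
    · subst ha
      rw [blockValues_cons_self, List.map_cons, List.prod_cons, one_mul, mul_assoc]
    · rw [blockValues_cons_of_ne ha, mul_assoc]

/-- Inverse images of star-free languages under the substitution that replaces each block
`c vᵢ` by the value of `vᵢ`. -/
theorem IsStarFree.blockValues_preimage [Finite A] {B : Set A} (hc : c ∈ B)
    (h : ∀ p : M, IsStarFree (languageOf fun w => (∀ a ∈ w, a ∈ B \ {c}) ∧ (w.map f).prod = p))
    {K : Language M} (hK : IsStarFree K) :
    IsStarFree (languageOf fun w => (∀ a ∈ w, a ∈ B) ∧ StartsWith c w ∧ (blockValues f c w).2 ∈ K) := by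
  induction hK with
  | empty => exact IsStarFree.empty.congr fun w => ⟨False.elim, fun h => h.2.2⟩
  | letter t =>
    refine ((IsStarFree.letter c).product (h t)).congr fun w => ?_
    rw [Language.mem_mul]
    constructor
    · rintro ⟨_, rfl, x, ⟨hx, rfl⟩, rfl⟩
      have hcx : c ∉ x := fun hc => (hx c hc).2 rfl
      refine ⟨?_, Or.inr ⟨x, rfl⟩, ?_⟩
      · intro a ha
        rcases List.mem_cons.1 ha with rfl | ha
        · exact hc
        · exact (hx a ha).1
      · rw [List.singleton_append, blockValues_cons_self, blockValues_of_notMem hcx]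
        rfl
    · rintro ⟨hB, rfl | ⟨x, rfl⟩, hx⟩
      · exact absurd (show ([] : List M) = [t] from hx) (by simp)
      · rw [blockValues_cons_self] at hx
        have hx : (blockValues f c x).1 :: (blockValues f c x).2 = [t] := hx
        simp only [List.cons.injEq] at hx
        have hcx := notMem_of_blockValues_snd hx.2
        rw [blockValues_of_notMem hcx] at hx
        exact ⟨[c], rfl, x, ⟨fun a ha => ⟨hB a (by simp [ha]), fun h => hcx (h ▸ ha)⟩, hx.1⟩, rfl⟩
  | union _ _ hK hL =>
    refine (hK.union hL).congr fun w => ⟨?_, ?_⟩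
    · rintro (⟨h₁, h₂, h₃⟩ | ⟨h₁, h₂, h₃⟩)
      · exact ⟨h₁, h₂, Or.inl h₃⟩
      · exact ⟨h₁, h₂, Or.inr h₃⟩
    · rintro ⟨h₁, h₂, h₃ | h₃⟩
      · exact Or.inl ⟨h₁, h₂, h₃⟩
      · exact Or.inr ⟨h₁, h₂, h₃⟩
  | product _ _ hK hL =>
    refine (hK.product hL).congr fun w => ?_
    rw [Language.mem_mul]
    constructor
    · rintro ⟨x, ⟨hx₁, hx₂, hx₃⟩, y, ⟨hy₁, hy₂, hy₃⟩, rfl⟩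
      refine ⟨fun a ha => (List.mem_append.1 ha).elim (hx₁ a) (hy₁ a), hx₂.append hy₂, ?_⟩
      rw [blockValues_append x hy₂]
      exact Language.append_mem_mul hx₃ hy₃
    · rintro ⟨h₁, h₂, h₃⟩
      obtain ⟨m₁, hm₁, m₂, hm₂, h₃⟩ := Language.mem_mul.1 h₃
      obtain ⟨x, y, rfl, hy, rfl, rfl⟩ := exists_append_of_blockValues_snd h₃.symm
      exact ⟨x, ⟨fun a ha => h₁ a (by simp [ha]), h₂.of_append, hm₁⟩, y,
        ⟨fun a ha => h₁ a (by simp [ha]), hy, hm₂⟩, rfl⟩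
  | inter _ _ hK hL =>
    refine (hK.inter hL).congr fun w => ⟨?_, ?_⟩
    · rintro ⟨⟨h₁, h₂, h₃⟩, -, -, h₄⟩
      exact ⟨h₁, h₂, h₃, h₄⟩
    · rintro ⟨h₁, h₂, h₃, h₄⟩
      exact ⟨⟨h₁, h₂, h₃⟩, h₁, h₂, h₄⟩
  | compl _ hL =>
    -- The complement must be cut back to the domain of the substitution, itself star-free.
    refine ((sublists B).inter ((one.union (cons_univ c)).inter hL.compl)).congr fun w => ⟨?_, ?_⟩
    · rintro ⟨h₁, h₂, h₃⟩
      exact ⟨h₁, h₂, fun h => h₃ ⟨h₁, h₂, h⟩⟩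
    · rintro ⟨h₁, h₂, h₃⟩
      exact ⟨h₁, h₂, fun h => h₃ h.2.2⟩

/-- The word is cut at its first and last c; y is empty when they coincide. -/
theorem exists_first_last_of_mem {w : List A} (h : c ∈ w) :
    ∃ x y z, w = x ++ (y ++ ([c] ++ z)) ∧ c ∉ x ∧ c ∉ z ∧ StartsWith c y := by
  obtain ⟨x, t, rfl, hx⟩ := List.eq_append_cons_of_mem h
  obtain ⟨z, y, ht, hz⟩ := List.eq_append_cons_of_mem
    (show c ∈ (c :: t).reverse by simp)
  have ht' : c :: t = y.reverse ++ ([c] ++ z.reverse) := by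
    rw [← List.reverse_reverse (c :: t), ht]
    simp
  refine ⟨x, y.reverse, z.reverse, by rw [ht'], hx, by simpa using hz, ?_⟩
  exact StartsWith.of_append (y := [c] ++ z.reverse) (ht' ▸ Or.inr ⟨t, rfl⟩)

/-- The alphabet is quantified inside the induction on the size of M because the local divisor is
used with M itself as alphabet; hence M and A share a universe. -/
theorem isStarFree_prod_eq (n : ℕ) : ∀ (M : Type u) [Monoid M] [Finite M], Nat.card M = n →
    PowStable M → ∀ (A : Type u) [Finite A] (f : A → M) (B : Set A) (p : M),
      IsStarFree (languageOf fun w => (∀ a ∈ w, a ∈ B) ∧ (w.map f).prod = p) := by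
  induction n using Nat.strong_induction_on with
  | _ n ihM =>
  intro M _ _ hn hM A _ f B
  induction B using WellFoundedLT.induction with
  | ind B ihB =>
  intro p
  by_cases hB : ∀ a ∈ B, f a = 1
  · have hprod : ∀ w : List A, (∀ a ∈ w, a ∈ B) → (w.map f).prod = 1 := fun w hw =>
      List.prod_eq_one fun m hm => by
        obtain ⟨a, ha, rfl⟩ := List.mem_map.1 hm
        exact hB a (hw a ha)
    by_cases hp : p = 1
    · exact (IsStarFree.sublists B).congr fun w =>
        ⟨fun h => ⟨h, (hprod w h).trans hp.symm⟩, fun h => h.1⟩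
    · exact IsStarFree.empty.congr fun w =>
        ⟨False.elim, fun h => hp (h.2.symm.trans (hprod w h.1))⟩
  · push Not at hB
    obtain ⟨c, hc, hfc⟩ := hB
    let F : M → Language A := fun p => languageOf fun w => (∀ a ∈ w, a ∈ B \ {c}) ∧ (w.map f).prod = p
    have hF : ∀ p, IsStarFree (F p) :=
      ihB (B \ {c}) (Set.sdiff_singleton_ssubset.2 hc)
    let K : LocalDivisor (f c) → Language M := fun q =>
      languageOf fun m => (∀ t ∈ m, t ∈ Set.univ) ∧ (m.map (LocalDivisor.sandwich (c := f c))).prod = q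
    have hK : ∀ q, IsStarFree (K q) := fun q =>
      ihM _ (hn ▸ LocalDivisor.card_lt hM hfc) _ rfl (LocalDivisor.powStable hM _) M _ _ q
    let Q : LocalDivisor (f c) → Language A := fun q =>
      languageOf fun w => (∀ a ∈ w, a ∈ B) ∧ StartsWith c w ∧ (blockValues f c w).2 ∈ K q
    have hQ : ∀ q, IsStarFree (Q q) := fun q => (hK q).blockValues_preimage hc hF
    -- The possible values of x, of yc and of z in w = x y c z with total value p; there are
    -- finitely many triples.
    let ι := {i : M × LocalDivisor (f c) × M // i.1 * (i.2.1.1 * i.2.2) = p}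
    have hι : ∀ i : ι, IsStarFree (F i.1.1 * (Q i.1.2.1 * ({[c]} * F i.1.2.2))) := fun i =>
      (hF _).product ((hQ _).product ((IsStarFree.letter c).product (hF _)))
    -- The c closing the middle part supplies the right-hand c of the last sandwich.
    have hval : ∀ w : List A, StartsWith c w →
        ((w ++ [c]).map f).prod =
          (((blockValues f c w).2.map (LocalDivisor.sandwich (c := f c))).prod).1 := by
      intro w hw
      rw [LocalDivisor.val_prod_sandwich, List.map_append, List.prod_append,
        prod_map_eq_blockValues (c := c), hw.blockValues_fst, one_mul]
      simp
    refine ((hF p).union (IsStarFree.iUnion hι)).congr fun w => ⟨?_, ?_⟩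
    · rintro (⟨h₁, h₂⟩ | ⟨⟨⟨p₁, q, p₂⟩, hp⟩, h⟩)
      · exact ⟨fun a ha => (h₁ a ha).1, h₂⟩
      · obtain ⟨x, ⟨hx, hx'⟩, _, h', rfl⟩ := Language.mem_mul.1 h
        obtain ⟨y, ⟨hy, hy', -, hq⟩, _, h'', rfl⟩ := Language.mem_mul.1 h'
        obtain ⟨_, rfl, z, ⟨hz, hz'⟩, rfl⟩ := Language.mem_mul.1 h''
        refine ⟨?_, ?_⟩
        · intro a ha
          simp only [List.mem_append, List.mem_singleton] at ha
          rcases ha with ha | ha | rfl | ha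
          · exact (hx a ha).1
          · exact hy a ha
          · exact hc
          · exact (hz a ha).1
        · rw [← hp, ← List.append_assoc y, List.map_append, List.prod_append,
            List.map_append (l₂ := z), List.prod_append, hval y hy', hq, hx', hz']
    · rintro ⟨hw, hp⟩
      by_cases hcw : c ∈ w
      · right
        obtain ⟨x, y, z, rfl, hx, hz, hy⟩ := exists_first_last_of_mem hcw
        simp only [List.mem_append, List.mem_singleton] at hw
        refine ⟨⟨⟨(x.map f).prod,
          ((blockValues f c y).2.map (LocalDivisor.sandwich (c := f c))).prod,
          (z.map f).prod⟩, ?_⟩, ?_⟩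
        · dsimp only
          rw [← hval y hy, ← hp, ← List.append_assoc y, List.map_append (l₁ := x),
            List.prod_append, List.map_append (l₂ := z), List.prod_append]
        · exact Language.append_mem_mul
            ⟨fun a ha => ⟨hw a (Or.inl ha), fun h => hx (h ▸ ha)⟩, rfl⟩
            (Language.append_mem_mul
              ⟨fun a ha => hw a (Or.inr (Or.inl ha)), hy, fun _ _ => trivial, rfl⟩
              (Language.append_mem_mul rfl
                ⟨fun a ha => ⟨hw a (Or.inr (Or.inr (Or.inr ha))), fun h => hz (h ▸ ha)⟩, rfl⟩))
      · exact Or.inl ⟨fun a ha => ⟨hw a ha, fun h => hcw (h ▸ ha)⟩, hp⟩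

/-- Schützenberger's theorem: languages recognized by finite aperiodic monoids are star-free. -/
theorem Recognizes.isStarFree [Finite A] [Finite M] (hM : PowStable M) {L : Language A}
    (hL : Recognizes M L) : IsStarFree L := by
  obtain ⟨φ, X, h⟩ := hL
  refine (IsStarFree.iUnion fun p : X => isStarFree_prod_eq _ M rfl hM A
    (fun a => φ (FreeMonoid.of a)) Set.univ p.1).congr fun w => ?_
  have hφ : φ (FreeMonoid.ofList w) = (w.map fun a => φ (FreeMonoid.of a)).prod := by
    induction w with
    | nil => simp
    | cons a w ih => rw [FreeMonoid.ofList_cons, map_mul, ih, List.map_cons, List.prod_cons]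
  rw [h, hφ]
  constructor
  · rintro ⟨⟨p, hp⟩, -, rfl⟩
    exact hp
  · intro hX
    exact ⟨⟨_, hX⟩, fun _ _ => trivial, rfl⟩

end Schutzenberger

end FOWords

theorem mainTheorem1 {A : Type u} [Finite A] (L : Language A) (hL : FOWords.IsRational L) :
    List.TFAE [
      FOWords.IsStarFree L,
      FOWords.IsFODefinable L,
      ∃ (M : Type v) (_ : Monoid M), Finite M ∧ FOWords.IsAperiodic M ∧ FOWords.Recognizes M L,
      FOWords.IsAperiodic (FOWords.SyntacticMonoid L)] := by
  -- Finiteness turns aperiodicity in 4 into the power identity, from which 3 and 1 follow.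
  have hfin : Finite (FOWords.SyntacticMonoid L) := FOWords.finite_syntacticMonoid hL.isRegular
  have hrec := FOWords.recognizes_syntacticMonoid L
  tfae_have 1 → 2 := FOWords.IsStarFree.isFODefinable
  tfae_have 2 → 4 := fun h => h.powStable_syntacticMonoid.isAperiodic
  tfae_have 4 → 3 := fun h => hrec.exists_small h.powStable
  tfae_have 3 → 4 := fun ⟨_, _, _, hM, h⟩ => (hM.powStable.syntacticMonoid h).isAperiodic
  tfae_have 4 → 1 := fun h => hrec.isStarFree h.powStable
  tfae_finish
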